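/- **Proposition (1-skeleton and weak order).** Let $V$ be a finite-dimensional real Euclidean space and $W\subseteq O(V)$ a finite reflection group, that is, a finite subgroup generated by orthogonal reflections $s_\alpha$ (the reflection in the hyperplane $\alpha^\perp$, $\alpha\neq 0$). Let $\Phi$ be a root system for $W$: a finite set of nonzero vectors, stable under $W$, such that $W=\langle s_\alpha \mid \alpha\in\Phi\rangle$ and $\mathbb R\alpha\cap\Phi=\{\alpha,-\alpha\}$ for every $\alpha\in\Phi$. Let $\boldsymbol a\in V$ be generic, i.e. fixed by no reflection of $W$, and let $\Delta$ be the simple system of $\Phi$ with $\langle \boldsymbol a,\alpha\rangle>0$ for all $\alpha\in\Delta$; here a simple system is a minimal subset of $\Phi^+$ generating the same convex cone as $\Phi^+$, where $\Phi^+$ is the set of roots on one side of a linear hyperplane that contains no root. Put $S=\{s_\alpha\mid\alpha\in\Delta\}$, let $\ell(w)$ be the minimal number of letters of a word in $S$ expressing $w\in W$, and let $\mathrm{Perm}^{\boldsymbol a}(W)=\mathrm{conv}\{w(\boldsymbol a)\mid w\in W\}$. The right weak order on $W$ is the relation $u\le v$ defined by $\ell(v)=\ell(u)+\ell(u^{-1}v)$.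 Then: 1. The right weak order is a partial order on $W$ and a lattice. 2. The map $w\mapsto w(\boldsymbol a)$ is a bijection from $W$ onto the vertex set of $\mathrm{Perm}^{\boldsymbol a}(W)$. Whenever the segment $[u(\boldsymbol a),v(\boldsymbol a)]$ is an edge, $\ell(u)\ne\ell(v)$; and if every edge is oriented from the endpoint of smaller length to the endpoint of larger length, the oriented $1$-skeleton (vertices and oriented edges) is the Hasse diagram of the right weak order: for $u,v\in W$ there is an oriented edge from $u(\boldsymbol a)$ to $v(\boldsymbol a)$ if and only if $v$ covers $u$. 3. The minimum of the right weak order is the identity $e$, and it has a maximum $w_o$, which is the unique element of maximal length. 4. For each nonempty face $F$ of $\mathrm{Perm}^{\boldsymbol a}(W)$ there are $u\le v$ in $W$ such that $\{w\in W\mid w(\boldsymbol a)\in F\}$ is the interval $[u,v]=\{w\mid u\le w\le v\}$, and $F=\mathrm{conv}\{w(\boldsymbol a)\mid w\in[u,v]\}$. -/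

import Mathlib

namespace CoxeterPerm

noncomputable section

variable {V : Type*} [NormedAddCommGroup V] [InnerProductSpace ℝ V]

/-- The orthogonal reflection `s_α`: it fixes the hyperplane `α^⊥` pointwise and maps `α` to `-α`. -/
def reflAlong (α : V) : V ≃ₗᵢ[ℝ] V := (ℝ ∙ α)ᗮ.reflection

/-- `g` is a reflection, i.e. `g = s_α` for some nonzero vector `α`. -/
def IsReflection (g : V ≃ₗᵢ[ℝ] V) : Prop := ∃ α : V, α ≠ 0 ∧ g = reflAlong α

/-- `W` is generated by the reflections it contains. -/
def IsReflectionGroup (W : Subgroup (V ≃ₗᵢ[ℝ] V)) : Prop :=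
  Subgroup.closure {g | g ∈ W ∧ IsReflection g} = W

/-- `Φ` is a root system for `W`. The empty set is allowed: it is the root system of the trivial
group. -/
structure IsRootSystem (W : Subgroup (V ≃ₗᵢ[ℝ] V)) (Φ : Set V) : Prop where
  finite : Φ.Finite
  ne_zero : ∀ α ∈ Φ, α ≠ 0
  closure_eq : Subgroup.closure (reflAlong '' Φ) = W
  line_inter : ∀ α ∈ Φ, (Submodule.span ℝ {α} : Set V) ∩ Φ = {α, -α}
  stable : ∀ w ∈ W, ∀ α ∈ Φ, w α ∈ Φ

/-- `P` is the set of roots on the positive side of a linear hyperplane that contains no root. -/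
def IsPositiveSystem (Φ P : Set V) : Prop :=
  ∃ f : V →ₗ[ℝ] ℝ, (∀ α ∈ Φ, f α ≠ 0) ∧ P = {α ∈ Φ | 0 < f α}

/-- `Δ` is a simple system of `Φ`: for some positive system `P`, it is an inclusion-minimal subset
of `P` generating the same convex cone as `P`. -/
def IsSimpleSystem (Φ Δ : Set V) : Prop :=
  ∃ P : Set V, IsPositiveSystem Φ P ∧
    Minimal (fun D : Set V => D ⊆ P ∧ PointedCone.hull ℝ D = PointedCone.hull ℝ P) Δ

/-- A point is generic if it is fixed by no reflection of `W`. -/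
def IsGeneric (W : Subgroup (V ≃ₗᵢ[ℝ] V)) (a : V) : Prop :=
  ∀ g ∈ W, IsReflection g → g a ≠ a

/-- The permutahedron: the convex hull of the `W`-orbit of `a`. -/
def perm (W : Subgroup (V ≃ₗᵢ[ℝ] V)) (a : V) : Set V :=
  convexHull ℝ (Set.range fun w : W => (w : V ≃ₗᵢ[ℝ] V) a)

/-- The set `S` of simple reflections `s_α`, `α ∈ Δ`, as elements of `W`. -/
def simpleReflections (W : Subgroup (V ≃ₗᵢ[ℝ] V)) (Δ : Set V) : Set W :=
  {s | ∃ α ∈ Δ, (s : V ≃ₗᵢ[ℝ] V) = reflAlong α}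

/-- The least number of letters of a word in the alphabet `S` that expresses `w`. -/
def length {G : Type*} [Group G] (S : Set G) (w : G) : ℕ :=
  sInf {n | ∃ l : List G, (∀ s ∈ l, s ∈ S) ∧ l.prod = w ∧ l.length = n}

/-- The right weak order: `v` is a product `u * x` with `ℓ(v) = ℓ(u) + ℓ(x)`. -/
def RightWeakLE {G : Type*} [Group G] (S : Set G) (u v : G) : Prop :=
  ∃ x : G, v = u * x ∧ length S v = length S u + length S x

/-- A nonempty face of `P`: the set of maximizers on `P` of a linear functional (the zero
functional gives `P` itself). -/
def IsFace (P F : Set V) : Prop := F.Nonempty ∧ IsExposed ℝ P F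

/-- An edge is a face of dimension one, the dimension being that of the affine span. -/
def IsEdge (P F : Set V) : Prop := IsFace P F ∧ Module.finrank ℝ (vectorSpan ℝ F) = 1

/-- The 1-skeleton of `P`: its nodes are the vertices of `P` (the points `x` such that `{x}` is a
face), and two vertices are adjacent if the segment joining them is an edge of `P`. -/
def oneSkeleton (P : Set V) : SimpleGraph (P.exposedPoints ℝ) where
  Adj x y := IsEdge P (segment ℝ (x : V) (y : V))
  symm := ⟨fun x y h => by rwa [segment_symm]⟩
  loopless := ⟨fun x h => by
    have h2 : Module.finrank ℝ (vectorSpan ℝ (segment ℝ (x : V) (x : V))) = 1 := h.2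
    rw [segment_same, vectorSpan_singleton, finrank_bot] at h2
    exact zero_ne_one h2⟩

end

end CoxeterPerm

namespace CoxeterPerm

noncomputable section

variable {V : Type*} [NormedAddCommGroup V] [InnerProductSpace ℝ V]

local notation "⟪" x "," y "⟫" => inner ℝ x y

/-! ### Reflections -/

/-! Everything is read off from inversion sets: to `w` belongs the set of roots positive on `a` and
negative on `w a`. Right multiplication by a simple reflection `s_α` adds or removes exactly one
inversion, the root `±w α`; with the exchange condition this shows that `w` is determined by its
inversions and that its length is their number (`length_eq_ncard_inversions`). Since `u⁻¹ * v` has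
as many inversions as the symmetric difference of those of `u` and `v`, lengths add exactly when the
inversions of `u` lie among those of `v` (`rightWeakLE_iff`). The weak order is thus an inclusion
order, with the identity at the bottom and the element inverting all positive roots at the top.

In a finite poset with a minimum it suffices for a lattice to join two covers of a common element.
Covers are `u * s` and `u * t` with `s`, `t` simple, and their join comes from the element of `⟨s,
t⟩` with most inversions (`exists_join_mul`).

A face is given by the maximizers of `⟪c, ·⟫` on the orbit, and `w a` is one iff it is positive on
every root on which `c` is positive (`mem_maximizers_iff`). This prescribes some inversions and
leaves the roots orthogonal to `c` free; tilting `c` by `±ε • a` picks the smallest and the largest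
solution, so the solutions form an interval. Edges are the intervals with two elements, that is, the
covers. -/

theorem reflAlong_apply (α x : V) :
    reflAlong α x = x - (2 * ⟪α, x⟫ / ⟪α, α⟫) • α := by
  unfold reflAlong
  rw [Submodule.reflection_orthogonal_apply, Submodule.reflection_singleton_apply,
    real_inner_self_eq_norm_sq, neg_sub, two_nsmul, ← add_smul]
  congr 2
  simp only [RCLike.ofReal_real_eq_id, id]
  ring

theorem reflAlong_self (α : V) : reflAlong α α = -α :=
  Submodule.reflection_orthogonalComplement_singleton_eq_neg α

theorem reflAlong_reflAlong (α x : V) : reflAlong α (reflAlong α x) = x :=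
  Submodule.reflection_reflection _ x

theorem reflAlong_mul_self (α : V) : reflAlong α * reflAlong α = 1 :=
  LinearIsometryEquiv.ext (reflAlong_reflAlong α)

theorem inner_reflAlong (α x y : V) : ⟪reflAlong α x, y⟫ = ⟪x, reflAlong α y⟫ := by
  conv_rhs => rw [← LinearIsometryEquiv.inner_map_map (reflAlong α), reflAlong_reflAlong]

theorem reflAlong_map (g : V ≃ₗᵢ[ℝ] V) (α : V) :
    reflAlong (g α) * g = g * reflAlong α := by
  ext x
  simp [LinearIsometryEquiv.coe_mul, reflAlong_apply]

theorem reflAlong_neg (α : V) : reflAlong (-α) = reflAlong α := by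
  ext x
  simp [reflAlong_apply, neg_div]

/-! ### Cones -/

theorem eq_zero_or_inner_pos_of_mem_hull {a : V} {D : Set V} (hD : ∀ δ ∈ D, 0 < ⟪a, δ⟫) {x : V}
    (hx : x ∈ PointedCone.hull ℝ D) : x = 0 ∨ 0 < ⟪a, x⟫ := by
  induction hx using Submodule.span_induction with
  | mem x h => exact .inr (hD x h)
  | zero => exact .inl rfl
  | add x y _ _ hx hy =>
    rcases hx with rfl | hx <;> rcases hy with rfl | hy
    · simp
    · simp [hy]
    · simp [hx]
    · right
      rw [inner_add_right]
      exact add_pos hx hy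
  | smul c x _ hx =>
    rcases hx with rfl | hx
    · simp
    rcases c.2.eq_or_lt with hc | hc
    · left
      rw [show c = 0 from Subtype.ext hc.symm, zero_smul]
    · right
      rw [Nonneg.mk_smul c.1 c.2 x, inner_smul_right]
      exact mul_pos hc hx

theorem inner_nonneg_of_mem_hull {a : V} {D : Set V} (hD : ∀ δ ∈ D, 0 ≤ ⟪a, δ⟫) {x : V}
    (hx : x ∈ PointedCone.hull ℝ D) : 0 ≤ ⟪a, x⟫ := by
  induction hx using Submodule.span_induction with
  | mem x h => exact hD x h
  | zero => simp
  | add x y _ _ hx hy =>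
    rw [inner_add_right]
    exact add_nonneg hx hy
  | smul c x _ hx =>
    rw [Nonneg.mk_smul c.1 c.2 x, inner_smul_right]
    exact mul_nonneg c.2 hx

theorem exists_of_mem_hull {D : Set V} {α : V} (hα : α ∈ D) {x : V}
    (hx : x ∈ PointedCone.hull ℝ D) :
    ∃ t : ℝ, 0 ≤ t ∧ ∃ z ∈ PointedCone.hull ℝ (D \ {α}), x = t • α + z := by
  rw [← Set.insert_sdiff_self_of_mem hα] at hx
  obtain ⟨t, z, hz, rfl⟩ := Submodule.mem_span_insert.1 hx
  exact ⟨t, t.2, z, hz, rfl⟩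

/-! ### Simple roots with respect to a point of the fundamental chamber -/

/-- `Δ` is the set of simple roots of the root system `Φ` of `W` that is positive on the regular
point `a`; the last two fields say that `Δ` spans the cone of positive roots, and that it consists of
vectors on extremal rays of this cone. -/
structure IsBasis (W : Subgroup (V ≃ₗᵢ[ℝ] V)) (Φ : Set V) (a : V) (Δ : Set V) : Prop where
  finite : Φ.Finite
  ne_zero : ∀ α ∈ Φ, α ≠ 0
  closure_eq : Subgroup.closure (reflAlong '' Φ) = W
  stable : ∀ w ∈ W, ∀ α ∈ Φ, w α ∈ Φ
  eq_or_eq_neg : ∀ α ∈ Φ, ∀ c : ℝ, c • α ∈ Φ → c • α = α ∨ c • α = -α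
  regular : ∀ α ∈ Φ, ⟪a, α⟫ ≠ 0
  subset : Δ ⊆ Φ
  pos : ∀ α ∈ Δ, 0 < ⟪a, α⟫
  mem_hull : ∀ β ∈ Φ, 0 < ⟪a, β⟫ → β ∈ PointedCone.hull ℝ Δ
  extremal : ∀ α ∈ Δ, ∀ x ∈ PointedCone.hull ℝ Δ, ∀ y ∈ PointedCone.hull ℝ Δ, ∀ c : ℝ,
    x + y = c • α → ∃ t : ℝ, x = t • α

theorem reflAlong_mem {W : Subgroup (V ≃ₗᵢ[ℝ] V)} {Φ : Set V}
    (h : Subgroup.closure (reflAlong '' Φ) = W) {α : V} (hα : α ∈ Φ) : reflAlong α ∈ W :=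
  h ▸ Subgroup.subset_closure (Set.mem_image_of_mem _ hα)

/-- The functional `f` behind `Δ` need not be `⟪a, ·⟫`, but both are positive on `Δ`, hence on its
cone, so they select the same positive roots. Extremality comes from minimality of `Δ`. -/
theorem IsRootSystem.isBasis {W : Subgroup (V ≃ₗᵢ[ℝ] V)} {Φ : Set V} (hΦ : IsRootSystem W Φ)
    {a : V} (ha : IsGeneric W a) {Δ : Set V} (hΔ : IsSimpleSystem Φ Δ)
    (haΔ : ∀ α ∈ Δ, 0 < ⟪a, α⟫) : IsBasis W Φ a Δ := by
  obtain ⟨P, ⟨f, hf, rfl⟩, ⟨hsub, hhull⟩, hmin⟩ := hΔ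
  have hreg : ∀ α ∈ Φ, ⟪a, α⟫ ≠ 0 := fun α hα h0 => by
    refine ha _ (reflAlong_mem hΦ.closure_eq hα) ⟨α, hΦ.ne_zero α hα, rfl⟩ ?_
    rw [reflAlong_apply, real_inner_comm, h0]
    simp
  have hneg : ∀ α ∈ Φ, -α ∈ Φ := fun α hα => by
    rw [← reflAlong_self]
    exact hΦ.stable _ (reflAlong_mem hΦ.closure_eq hα) α hα
  refine ⟨hΦ.finite, hΦ.ne_zero, hΦ.closure_eq, hΦ.stable, ?_, hreg, fun α hα => (hsub hα).1, haΔ,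
    ?_, ?_⟩
  · intro α hα c hc
    have : c • α ∈ (Submodule.span ℝ {α} : Set V) ∩ Φ :=
      ⟨Submodule.smul_mem _ _ (Submodule.mem_span_singleton_self α), hc⟩
    rw [hΦ.line_inter α hα] at this
    exact this
  · intro β hβ hpos
    rw [hhull]
    refine PointedCone.subset_hull ⟨hβ, (hf β hβ).lt_or_gt.resolve_left fun hlt => ?_⟩
    have hmem : -β ∈ PointedCone.hull ℝ Δ := by
      rw [hhull]
      exact PointedCone.subset_hull ⟨hneg β hβ, by simpa using hlt⟩
    have := inner_nonneg_of_mem_hull (fun δ hδ => (haΔ δ hδ).le) hmem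
    rw [inner_neg_right] at this
    linarith
  · intro α hα x hx y hy c hxy
    obtain ⟨t, ht, z, hz, rfl⟩ := exists_of_mem_hull hα hx
    obtain ⟨t', ht', z', hz', rfl⟩ := exists_of_mem_hull hα hy
    have hzz : z + z' = (c - t - t') • α := by
      rw [sub_smul, sub_smul, ← hxy]
      abel
    -- A positive coefficient would put `α` in the cone of the other simple roots, making it
    -- redundant; otherwise pairing with `a` forces `z = 0`.
    rcases lt_or_ge 0 (c - t - t') with hc | hc
    · have hmem : α ∈ PointedCone.hull ℝ (Δ \ {α}) := by
        have := PointedCone.smul_mem _ (inv_nonneg.2 hc.le) (Submodule.add_mem _ hz hz')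
        rwa [hzz, smul_smul, inv_mul_cancel₀ hc.ne', one_smul] at this
      have hle : PointedCone.hull ℝ (Δ \ {α}) = PointedCone.hull ℝ Δ := by
        refine le_antisymm (Submodule.span_mono Set.sdiff_subset) (Submodule.span_le.2 fun δ hδ => ?_)
        by_cases h : δ = α
        · exact h ▸ hmem
        · exact Submodule.subset_span ⟨hδ, h⟩
      exact absurd rfl (hmin ⟨Set.sdiff_subset.trans hsub, hle.trans hhull⟩ Set.sdiff_subset hα).2
    · have hD : ∀ δ ∈ Δ \ {α}, 0 < ⟪a, δ⟫ := fun δ hδ => haΔ δ hδ.1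
      rcases eq_zero_or_inner_pos_of_mem_hull hD hz with rfl | hz0
      · exact ⟨t, add_zero _⟩
      · have h1 := inner_nonneg_of_mem_hull (fun δ hδ => (hD δ hδ).le) hz'
        have h2 := congrArg (inner ℝ a) hzz
        rw [inner_add_right, inner_smul_right] at h2
        nlinarith [haΔ α hα]

namespace IsBasis

variable {W : Subgroup (V ≃ₗᵢ[ℝ] V)} {Φ Δ : Set V} {a : V}

theorem neg_mem (h : IsBasis W Φ a Δ) {α : V} (hα : α ∈ Φ) : -α ∈ Φ := by
  rw [← reflAlong_self]
  exact h.stable _ (reflAlong_mem h.closure_eq hα) α hα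

theorem map_mem (h : IsBasis W Φ a Δ)
    (w : W) {α : V} (hα : α ∈ Φ) : w.1 α ∈ Φ := h.stable _ w.2 α hα

theorem reflAlong_mem_root (h : IsBasis W Φ a Δ)
    {α β : V} (hα : α ∈ Φ) (hβ : β ∈ Φ) : reflAlong α β ∈ Φ :=
  h.stable _ (reflAlong_mem h.closure_eq hα) β hβ

/-- A simple reflection permutes the positive roots other than the simple root. -/
theorem inner_reflAlong_pos (h : IsBasis W Φ a Δ)
    {α β : V} (hα : α ∈ Δ) (hβ : β ∈ Φ) (hpos : 0 < ⟪a, β⟫)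
    (hne : β ≠ α) : 0 < ⟪a, reflAlong α β⟫ := by
  have hr := h.reflAlong_mem_root (h.subset hα) hβ
  refine (h.regular _ hr).lt_or_gt.resolve_left fun hlt => hne ?_
  have hmem : -reflAlong α β ∈ PointedCone.hull ℝ Δ :=
    h.mem_hull _ (h.neg_mem hr) (by rwa [inner_neg_right, neg_pos])
  -- If `s_α β` were negative, `β` and `-s_α β` would be two vectors of the cone whose sum is a
  -- multiple of `α`.
  obtain ⟨t, rfl⟩ := h.extremal α hα β (h.mem_hull β hβ hpos) _ hmem
    (2 * ⟪α, β⟫ / ⟪α, α⟫) (by rw [reflAlong_apply]; abel)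
  refine (h.eq_or_eq_neg α (h.subset hα) t hβ).resolve_right fun h' => ?_
  rw [h', inner_neg_right] at hpos
  linarith [h.pos α hα]

theorem inner_reflAlong_pos_iff (h : IsBasis W Φ a Δ)
    {α β : V} (hα : α ∈ Δ) (hβ : β ∈ Φ) (h1 : β ≠ α) (h2 : β ≠ -α) :
    0 < ⟪a, reflAlong α β⟫ ↔ 0 < ⟪a, β⟫ := by
  refine ⟨fun hp => ?_, fun hp => h.inner_reflAlong_pos hα hβ hp h1⟩
  have := h.inner_reflAlong_pos hα (h.reflAlong_mem_root (h.subset hα) hβ) hp fun h' => h2 <| by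
    rw [← reflAlong_reflAlong α β, h', reflAlong_self]
  rwa [reflAlong_reflAlong] at this

theorem inner_neg_iff (h : IsBasis W Φ a Δ) {β : V} (hβ : β ∈ Φ) : ⟪a, β⟫ < 0 ↔ ¬ 0 < ⟪a, β⟫ :=
  ⟨fun h => h.not_gt, fun h' => (h.regular β hβ).lt_or_gt.resolve_right h'⟩

end IsBasis

/-! ### Inversions -/

/-- The positive roots whose hyperplanes separate `a` from `w a`. -/
def inversions {W : Subgroup (V ≃ₗᵢ[ℝ] V)} (Φ : Set V) (a : V) (w : W) : Set V :=
  {β ∈ Φ | 0 < ⟪a, β⟫ ∧ ⟪w.1 a, β⟫ < 0}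

theorem apply_inv_apply {W : Subgroup (V ≃ₗᵢ[ℝ] V)} (w : W) (x : V) : w.1 (w⁻¹.1 x) = x :=
  w.1.apply_symm_apply x

theorem inv_apply_apply {W : Subgroup (V ≃ₗᵢ[ℝ] V)} (w : W) (x : V) : w⁻¹.1 (w.1 x) = x :=
  w.1.symm_apply_apply x

theorem inner_apply_left {W : Subgroup (V ≃ₗᵢ[ℝ] V)} (w : W) (x y : V) :
    ⟪w.1 x, y⟫ = ⟪x, w⁻¹.1 y⟫ := by
  rw [← LinearIsometryEquiv.inner_map_map w.1 x, apply_inv_apply]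

theorem coe_mul_apply {W : Subgroup (V ≃ₗᵢ[ℝ] V)} (u v : W) (x : V) :
    (u * v).1 x = u.1 (v.1 x) := rfl

theorem mul_self_of_eq_reflAlong {W : Subgroup (V ≃ₗᵢ[ℝ] V)} {s : W} {α : V}
    (hs : s.1 = reflAlong α) : s * s = 1 :=
  Subtype.ext <| by rw [Subgroup.coe_mul, hs, reflAlong_mul_self]; rfl

theorem inversions_one {W : Subgroup (V ≃ₗᵢ[ℝ] V)} (Φ : Set V) (a : V) :
    inversions Φ a (1 : W) = ∅ :=
  Set.eq_empty_of_forall_notMem fun _ hβ => lt_asymm hβ.2.1 hβ.2.2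

namespace IsBasis

variable {W : Subgroup (V ≃ₗᵢ[ℝ] V)} {Φ Δ : Set V} {a : V}

theorem finite_inversions (h : IsBasis W Φ a Δ)
    (w : W) : (inversions Φ a w).Finite := h.finite.subset fun _ hβ => hβ.1

theorem apply_regular (h : IsBasis W Φ a Δ) (w : W) {β : V} (hβ : β ∈ Φ) : ⟪w.1 a, β⟫ ≠ 0 := by
  rw [inner_apply_left]
  exact h.regular _ (h.map_mem _ hβ)

theorem exists_simple (h : IsBasis W Φ a Δ) {α : V} (hα : α ∈ Δ) :
    ∃ s : W, s.1 = reflAlong α ∧ s ∈ simpleReflections W Δ :=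
  ⟨⟨_, reflAlong_mem h.closure_eq (h.subset hα)⟩, rfl, α, hα, rfl⟩

/-- Apart from `±α`, the reflection `s` preserves the sign of every root, so only `β = ±w α` can
change status. -/
theorem inversions_mul (h : IsBasis W Φ a Δ) {w s : W} {α : V} (hα : α ∈ Δ) (hs : s.1 = reflAlong α)
    (hw : 0 < ⟪a, w.1 α⟫) : inversions Φ a (w * s) = insert (w.1 α) (inversions Φ a w) := by
  ext β
  simp only [inversions, Set.mem_ofPred_eq, Set.mem_insert_iff]
  rw [coe_mul_apply, inner_apply_left w, inner_apply_left w, hs, inner_reflAlong]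
  have hα0 := h.pos α hα
  by_cases h1 : w⁻¹.1 β = α
  · have hβ : β = w.1 α := by rw [← h1, apply_inv_apply]
    rw [h1, reflAlong_self, inner_neg_right]
    simp [hβ, hw, hα0, h.map_mem w (h.subset hα)]
  by_cases h2 : w⁻¹.1 β = -α
  · have hβ : β = -w.1 α := by rw [← map_neg, ← h2, apply_inv_apply]
    have hlt : ⟪a, β⟫ < 0 := by rw [hβ, inner_neg_right]; linarith
    refine ⟨fun hh => absurd hh.2.1 hlt.not_gt, ?_⟩
    rintro (rfl | hh)
    · exact absurd hlt hw.not_gt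
    · exact absurd hh.2.1 hlt.not_gt
  have hne : β ≠ w.1 α := by
    rintro rfl
    exact h1 (inv_apply_apply w α)
  simp only [hne, false_or]
  refine and_congr_right fun hβ => and_congr_right fun _ => ?_
  have hβ' := h.map_mem w⁻¹ hβ
  rw [h.inner_neg_iff hβ', h.inner_neg_iff (h.reflAlong_mem_root (h.subset hα) hβ'),
    h.inner_reflAlong_pos_iff hα hβ' h1 h2]

theorem notMem_inversions (h : IsBasis W Φ a Δ)
    {w : W} {α : V} (hα : α ∈ Δ) : w.1 α ∉ inversions Φ a w := fun hh => by
  have := hh.2.2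
  rw [LinearIsometryEquiv.inner_map_map] at this
  exact this.not_gt (h.pos α hα)

theorem ncard_inversions_mul (h : IsBasis W Φ a Δ)
    {w s : W} {α : V} (hα : α ∈ Δ) (hs : s.1 = reflAlong α)
    (hw : 0 < ⟪a, w.1 α⟫) :
    (inversions Φ a (w * s)).ncard = (inversions Φ a w).ncard + 1 := by
  rw [h.inversions_mul hα hs hw,
    Set.ncard_insert_of_notMem (h.notMem_inversions hα) (h.finite_inversions w)]

theorem ncard_inversions_of_neg (h : IsBasis W Φ a Δ)
    {w s : W} {α : V} (hα : α ∈ Δ) (hs : s.1 = reflAlong α)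
    (hw : ⟪a, w.1 α⟫ < 0) :
    (inversions Φ a w).ncard = (inversions Φ a (w * s)).ncard + 1 := by
  have := h.ncard_inversions_mul (w := w * s) hα hs (by
    rw [coe_mul_apply, hs, reflAlong_self, map_neg, inner_neg_right]; linarith)
  rwa [mul_assoc, mul_self_of_eq_reflAlong hs, mul_one] at this

/-- If `u` and `v` have different inversions, a wall of the chamber of `u a` separates it from
`v a`. -/
theorem exists_inner_neg (h : IsBasis W Φ a Δ) {u v : W} (huv : inversions Φ a (u⁻¹ * v) ≠ ∅) :
    ∃ α ∈ Δ, ⟪v.1 a, u.1 α⟫ < 0 := by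
  obtain ⟨β, hβ, hpos, hneg⟩ := Set.nonempty_iff_ne_empty.2 huv
  by_contra! hcon
  refine hneg.not_ge (inner_nonneg_of_mem_hull (fun δ hδ => ?_) (h.mem_hull β hβ hpos))
  rw [coe_mul_apply, inner_apply_left, inv_inv]
  exact hcon δ hδ

theorem inner_apply_pos_of_inversions_eq_empty (h : IsBasis W Φ a Δ)
    {w : W} (hw : inversions Φ a w = ∅) {β : V}
    (hβ : β ∈ Φ) (hpos : 0 < ⟪a, β⟫) : 0 < ⟪a, w.1 β⟫ := by
  by_contra hcon
  have hmem : -w.1 β ∈ inversions Φ a w := by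
    refine ⟨h.neg_mem (h.map_mem w hβ), ?_, ?_⟩
    · rw [inner_neg_right, neg_pos, h.inner_neg_iff (h.map_mem w hβ)]
      exact hcon
    · rw [inner_neg_right, LinearIsometryEquiv.inner_map_map]
      linarith
  rw [hw] at hmem
  exact hmem

/-! ### Words in the simple reflections -/

/-- Take a bad positive root `γ` of least height `⟪a, γ⟫`. Some simple `δ` has `⟪γ, δ⟫ > 0`, so `s_δ
γ` is lower and still positive, and `s_γ` is the conjugate of its reflection by `s_δ`. -/
theorem reflAlong_mem_closure (h : IsBasis W Φ a Δ) {β : V} (hβ : β ∈ Φ) :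
    reflAlong β ∈ Subgroup.closure (reflAlong '' Δ) := by
  suffices hs : ∀ β ∈ Φ, 0 < ⟪a, β⟫ → reflAlong β ∈ Subgroup.closure (reflAlong '' Δ) by
    rcases (h.regular β hβ).lt_or_gt with h0 | h0
    · rw [← reflAlong_neg]
      exact hs _ (h.neg_mem hβ) (by rwa [inner_neg_right, neg_pos])
    · exact hs β hβ h0
  by_contra! hcon
  obtain ⟨γ, ⟨hγ, hpos, hbad⟩, hmin⟩ := Set.exists_min_image
    {β | β ∈ Φ ∧ 0 < ⟪a, β⟫ ∧ reflAlong β ∉ Subgroup.closure (reflAlong '' Δ)} (fun β => ⟪a, β⟫)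
    (h.finite.subset fun _ hβ => hβ.1) hcon
  obtain ⟨δ, hδ, hγδ⟩ : ∃ δ ∈ Δ, 0 < ⟪γ, δ⟫ := by
    by_contra! hneg
    have h1 := inner_nonneg_of_mem_hull (a := -γ) (fun δ hδ => by
      rw [inner_neg_left]; linarith [hneg δ hδ]) (h.mem_hull γ hγ hpos)
    rw [inner_neg_left] at h1
    linarith [real_inner_self_pos.2 (h.ne_zero γ hγ)]
  have hδmem : reflAlong δ ∈ Subgroup.closure (reflAlong '' Δ) :=
    Subgroup.subset_closure (Set.mem_image_of_mem _ hδ)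
  have hne : γ ≠ δ := by
    rintro rfl
    exact hbad hδmem
  have hlt : ⟪a, reflAlong δ γ⟫ < ⟪a, γ⟫ := by
    rw [reflAlong_apply, inner_sub_right, inner_smul_right, sub_lt_self_iff]
    have h1 := real_inner_self_pos.2 (h.ne_zero δ (h.subset hδ))
    have h2 := h.pos δ hδ
    rw [real_inner_comm] at hγδ
    positivity
  have hgood : reflAlong (reflAlong δ γ) ∈ Subgroup.closure (reflAlong '' Δ) := by
    by_contra hbad'
    exact hlt.not_ge (hmin _ ⟨h.reflAlong_mem_root (h.subset hδ) hγ,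
      h.inner_reflAlong_pos hδ hγ hpos hne, hbad'⟩)
  refine hbad ?_
  have := Subgroup.mul_mem _ (Subgroup.mul_mem _ hδmem hgood) hδmem
  rwa [mul_assoc, reflAlong_map, ← mul_assoc, reflAlong_mul_self, one_mul] at this

theorem exists_list (h : IsBasis W Φ a Δ)
    (w : W) : ∃ l : List W, (∀ s ∈ l, s ∈ simpleReflections W Δ) ∧ l.prod = w := by
  obtain ⟨g, hg⟩ := w
  have hg' : g ∈ Subgroup.closure (reflAlong '' Δ) := by
    have hle : Subgroup.closure (reflAlong '' Φ) ≤ Subgroup.closure (reflAlong '' Δ) := by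
      rw [Subgroup.closure_le]
      rintro _ ⟨β, hβ, rfl⟩
      exact h.reflAlong_mem_closure hβ
    rw [h.closure_eq] at hle
    exact hle hg
  suffices hs : ∃ l : List W, (∀ s ∈ l, s ∈ simpleReflections W Δ) ∧ l.prod.1 = g by
    obtain ⟨l, hl, hlg⟩ := hs
    exact ⟨l, hl, Subtype.ext hlg⟩
  clear hg
  induction hg' using Subgroup.closure_induction with
  | mem x hx =>
    obtain ⟨α, hα, rfl⟩ := hx
    obtain ⟨s, hs, hsS⟩ := h.exists_simple hα
    exact ⟨[s], by simpa using hsS, by simpa using hs⟩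
  | one => exact ⟨[], by simp, by simp⟩
  | mul x y _ _ hx hy =>
    obtain ⟨l, hl, rfl⟩ := hx
    obtain ⟨l', hl', rfl⟩ := hy
    refine ⟨l ++ l', fun s hs => ?_, by simp⟩
    exact (List.mem_append.1 hs).elim (hl s) (hl' s)
  | inv x _ hx =>
    obtain ⟨l, hl, rfl⟩ := hx
    refine ⟨(l.map (·⁻¹)).reverse, fun s hs => ?_, by rw [← List.prod_inv_reverse]; rfl⟩
    simp only [List.mem_reverse, List.mem_map] at hs
    obtain ⟨t, ht, rfl⟩ := hs
    obtain ⟨α, hα, hs⟩ := hl t ht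
    rw [inv_eq_of_mul_eq_one_left (mul_self_of_eq_reflAlong hs)]
    exact hl t ht

/-- The exchange condition. -/
theorem exchange (h : IsBasis W Φ a Δ)
    {l : List W} (hl : ∀ s ∈ l, s ∈ simpleReflections W Δ) {t : W} {α : V}
    (hα : α ∈ Δ) (ht : t.1 = reflAlong α) (hneg : ⟪a, l.prod.1 α⟫ < 0) :
    ∃ l' : List W, (∀ s ∈ l', s ∈ simpleReflections W Δ) ∧ l'.length < l.length ∧
      l'.prod = l.prod * t := by
  induction l with
  | nil => exact absurd (h.pos α hα) hneg.not_gt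
  | cons s l ih =>
    have hl' : ∀ s ∈ l, s ∈ simpleReflections W Δ := fun x hx => hl x (List.mem_cons_of_mem _ hx)
    have hmem := h.map_mem l.prod (h.subset hα)
    -- Either the tail already makes `α` negative, or the first letter does; in the latter case the
    -- tail maps `α` to the root of that letter, which can be deleted.
    rcases (h.regular _ hmem).lt_or_gt with h0 | h0
    · obtain ⟨l', h1, h2, h3⟩ := ih hl' h0
      refine ⟨s :: l', fun x hx => ?_, by simpa using h2, by simp [h3, mul_assoc]⟩
      rcases List.mem_cons.1 hx with rfl | hx
      · exact hl x List.mem_cons_self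
      · exact h1 x hx
    · refine ⟨l, hl', by simp, ?_⟩
      obtain ⟨δ, hδ, hs⟩ := hl s List.mem_cons_self
      rw [List.prod_cons, coe_mul_apply, hs] at hneg
      have heq : l.prod.1 α = δ := by
        by_contra hne
        exact hneg.not_gt (h.inner_reflAlong_pos hδ hmem h0 hne)
      have hcomm : s * l.prod = l.prod * t := Subtype.ext <| by
        rw [Subgroup.coe_mul, Subgroup.coe_mul, hs, ht, ← heq, reflAlong_map]
      rw [List.prod_cons, hcomm, mul_assoc, mul_self_of_eq_reflAlong ht, mul_one]

/-- Such a `w` keeps `α` positive for the last letter `s_α` of a word, so the prefix makes `α`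
negative, and exchange yields a strictly shorter word for `w`; descend to the empty word. -/
theorem eq_one_of_inversions_eq_empty (h : IsBasis W Φ a Δ)
    {w : W} (hw : inversions Φ a w = ∅) : w = 1 := by
  obtain ⟨l, hl, hlw⟩ := h.exists_list w
  induction hn : l.length using Nat.strong_induction_on generalizing l with
  | _ n ih =>
    rcases List.eq_nil_or_concat' l with rfl | ⟨l, t, rfl⟩
    · exact hlw.symm
    obtain ⟨α, hα, ht⟩ := hl t (by simp)
    have hpos := h.inner_apply_pos_of_inversions_eq_empty hw (h.subset hα) (h.pos α hα)
    rw [← hlw, List.prod_append, List.prod_singleton, coe_mul_apply, ht, reflAlong_self, map_neg,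
      inner_neg_right, neg_pos] at hpos
    obtain ⟨l', h1, h2, h3⟩ := h.exchange (fun s hs => hl s (by simp [hs])) hα ht hpos
    refine ih l'.length ?_ l' h1 ?_ rfl
    · rw [← hn, List.length_append, List.length_singleton]
      omega
    · rw [h3, ← hlw, List.prod_append, List.prod_singleton]

theorem exists_list_length (h : IsBasis W Φ a Δ) (w : W) :
    ∃ l : List W, (∀ s ∈ l, s ∈ simpleReflections W Δ) ∧ l.prod = w ∧
      l.length = (inversions Φ a w).ncard := by
  induction hn : (inversions Φ a w).ncard generalizing w with
  | zero =>
    rw [Set.ncard_eq_zero (h.finite_inversions w)] at hn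
    exact ⟨[], by simp, (h.eq_one_of_inversions_eq_empty hn).symm, rfl⟩
  | succ n ih =>
    -- If `w` kept all simple roots positive it would keep the whole cone nonnegative, including
    -- `-w⁻¹ β` for an inversion `β`.
    obtain ⟨α, hα, hneg⟩ : ∃ α ∈ Δ, ⟪a, w.1 α⟫ < 0 := by
      by_contra! hcon
      obtain ⟨β, hβ, h1, h2⟩ : (inversions Φ a w).Nonempty :=
        Set.nonempty_of_ncard_ne_zero (by omega)
      rw [inner_apply_left] at h2
      have h3 := inner_nonneg_of_mem_hull (a := w⁻¹.1 a) (fun δ hδ => by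
        rw [inner_apply_left, inv_inv]; exact hcon δ hδ) (h.mem_hull (-w⁻¹.1 β)
          (h.neg_mem (h.map_mem _ hβ)) (by rwa [inner_neg_right, neg_pos]))
      rw [inner_neg_right, LinearIsometryEquiv.inner_map_map] at h3
      linarith
    obtain ⟨s, hs, hsS⟩ := h.exists_simple hα
    have hcard := h.ncard_inversions_of_neg hα hs hneg
    obtain ⟨l, h1, h2, h3⟩ := ih (w * s) (by omega)
    refine ⟨l ++ [s], fun x hx => ?_, ?_, by simp [h3]⟩
    · rcases List.mem_append.1 hx with hx | hx
      · exact h1 x hx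
      · rwa [List.mem_singleton.1 hx]
    · rw [List.prod_append, List.prod_singleton, h2, mul_assoc, mul_self_of_eq_reflAlong hs,
        mul_one]

theorem ncard_inversions_prod_le (h : IsBasis W Φ a Δ)
    {l : List W} (hl : ∀ s ∈ l, s ∈ simpleReflections W Δ) :
    (inversions Φ a l.prod).ncard ≤ l.length := by
  induction l using List.reverseRecOn with
  | nil => simp [inversions_one]
  | append_singleton l s ih =>
    have := ih fun x hx => hl x (by simp [hx])
    obtain ⟨α, hα, hs⟩ := hl s (by simp)
    rw [List.prod_append, List.prod_singleton, List.length_append, List.length_singleton]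
    rcases (h.regular _ (h.map_mem l.prod (h.subset hα))).lt_or_gt with h0 | h0
    · have := h.ncard_inversions_of_neg hα hs h0
      omega
    · have := h.ncard_inversions_mul hα hs h0
      omega

theorem length_eq_ncard_inversions (h : IsBasis W Φ a Δ) (w : W) :
    length (simpleReflections W Δ) w = (inversions Φ a w).ncard := by
  refine le_antisymm (Nat.sInf_le (h.exists_list_length w)) (le_csInf ⟨_, h.exists_list_length w⟩ ?_)
  rintro _ ⟨l, hl, rfl, rfl⟩
  exact h.ncard_inversions_prod_le hl

/-! ### The weak order is the inclusion order of inversion sets -/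

/-- The image consists of the roots `γ` positive on `u a` and negative on `v a`; the two parts of
the union correspond to the sign of `γ` on `a`. -/
theorem image_inversions (h : IsBasis W Φ a Δ) (u v : W) :
    u.1 '' inversions Φ a (u⁻¹ * v) = (inversions Φ a v \ inversions Φ a u) ∪
      Neg.neg '' (inversions Φ a u \ inversions Φ a v) := by
  ext γ
  have h1 : γ ∈ u.1 '' inversions Φ a (u⁻¹ * v) ↔ γ ∈ Φ ∧ 0 < ⟪u.1 a, γ⟫ ∧ ⟪v.1 a, γ⟫ < 0 := by
    constructor
    · rintro ⟨β, ⟨hβ, hp, hn⟩, rfl⟩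
      rw [coe_mul_apply, inner_apply_left, inv_inv] at hn
      exact ⟨h.map_mem u hβ, by rwa [LinearIsometryEquiv.inner_map_map], hn⟩
    · rintro ⟨hγ, hp, hn⟩
      refine ⟨u⁻¹.1 γ, ⟨h.map_mem _ hγ, by rwa [← inner_apply_left], ?_⟩, apply_inv_apply u γ⟩
      rwa [coe_mul_apply, LinearIsometryEquiv.inner_map_map]
  rw [h1, Set.image_neg_eq_neg]
  simp only [inversions, Set.mem_union, Set.mem_sdiff, Set.mem_neg, Set.mem_ofPred_eq,
    inner_neg_right, neg_pos, Left.neg_neg_iff]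
  constructor
  · rintro ⟨hγ, hp, hn⟩
    rcases (h.regular γ hγ).lt_or_gt with h0 | h0
    · exact .inr ⟨⟨h.neg_mem hγ, h0, hp⟩, fun hh => hn.not_gt hh.2.2⟩
    · exact .inl ⟨⟨hγ, h0, hn⟩, fun hh => hp.not_gt hh.2.2⟩
  · rintro (⟨⟨hγ, h0, hn⟩, hh⟩ | ⟨⟨hγ, h0, hn⟩, hh⟩)
    · exact ⟨hγ, (h.apply_regular u hγ).lt_or_gt.resolve_left fun h2 => hh ⟨hγ, h0, h2⟩, hn⟩
    · have hγ' : γ ∈ Φ := by simpa using h.neg_mem hγ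
      exact ⟨hγ', hn, (h.apply_regular v hγ').lt_or_gt.resolve_right fun h2 => hh ⟨hγ, h0, h2⟩⟩

theorem ncard_inversions_inv_mul (h : IsBasis W Φ a Δ) (u v : W) :
    (inversions Φ a (u⁻¹ * v)).ncard = (inversions Φ a v \ inversions Φ a u).ncard +
      (inversions Φ a u \ inversions Φ a v).ncard := by
  rw [← Set.ncard_image_of_injective _ u.1.injective, h.image_inversions,
    Set.ncard_union_eq ?_ ?_ ?_, Set.ncard_image_of_injective _ neg_injective]
  · rw [Set.disjoint_left]
    rintro _ hβ ⟨γ, hγ, rfl⟩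
    have h1 := hβ.1.2.1
    rw [inner_neg_right] at h1
    linarith [hγ.1.2.1]
  · exact (h.finite_inversions v).subset Set.sdiff_subset
  · exact ((h.finite_inversions u).subset Set.sdiff_subset).image _

theorem inversions_injective (h : IsBasis W Φ a Δ)
    : Function.Injective (inversions Φ a : W → Set V) := fun u v huv => by
  have := h.ncard_inversions_inv_mul u v
  rw [huv, Set.sdiff_self, Set.ncard_empty, Set.ncard_eq_zero (h.finite_inversions _)] at this
  exact inv_mul_eq_one.1 (h.eq_one_of_inversions_eq_empty this)

theorem rightWeakLE_iff (h : IsBasis W Φ a Δ) (u v : W) :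
    RightWeakLE (simpleReflections W Δ) u v ↔ inversions Φ a u ⊆ inversions Φ a v := by
  have h1 := h.ncard_inversions_inv_mul u v
  have h2 := Set.ncard_inter_add_ncard_sdiff_eq_ncard (inversions Φ a u) (inversions Φ a v)
    (h.finite_inversions u)
  have h3 := Set.ncard_inter_add_ncard_sdiff_eq_ncard (inversions Φ a v) (inversions Φ a u)
    (h.finite_inversions v)
  rw [Set.inter_comm] at h3
  have h4 : inversions Φ a u ⊆ inversions Φ a v ↔
      (inversions Φ a u \ inversions Φ a v).ncard = 0 := by
    rw [Set.ncard_eq_zero ((h.finite_inversions u).subset Set.sdiff_subset), Set.sdiff_eq_empty]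
  rw [h4]
  constructor
  · rintro ⟨x, rfl, hx⟩
    simp only [h.length_eq_ncard_inversions] at hx
    rw [inv_mul_cancel_left] at h1
    omega
  · intro h0
    refine ⟨u⁻¹ * v, by simp, ?_⟩
    simp only [h.length_eq_ncard_inversions]
    omega

end IsBasis

/-! ### A local criterion for lattices -/

/-- In a finite poset where any two covers of a common element have a join, any two elements with a
common lower bound have a join. -/
theorem exists_isLUB_of_covBy {X : Type*} [PartialOrder X] [Finite X]
    (hcov : ∀ z x y : X, z ⋖ x → z ⋖ y → ∃ j, IsLUB {x, y} j) (z : X) :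
    ∀ x y : X, z ≤ x → z ≤ y → ∃ j, IsLUB {x, y} j := by
  induction z using WellFoundedGT.induction with
  | _ z ih =>
    intro x y hx hy
    rcases hx.eq_or_lt with rfl | hx
    · refine ⟨y, ?_, fun b hb => hb (by simp)⟩
      rintro _ (rfl | rfl)
      exacts [hy, le_rfl]
    rcases hy.eq_or_lt with rfl | hy
    · refine ⟨x, ?_, fun b hb => hb (by simp)⟩
      rintro _ (rfl | rfl)
      exacts [le_rfl, hx.le]
    obtain ⟨x', hzx, hxx⟩ := exists_covBy_le_of_lt hx
    obtain ⟨y', hzy, hyy⟩ := exists_covBy_le_of_lt hy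
    obtain ⟨j, hj⟩ := hcov z x' y' hzx hzy
    -- Join `x` with `j` above `x'`, then the result with `y` above `y'`. Any upper bound of `x` and
    -- `y` dominates `j`, hence both joins.
    obtain ⟨k, hk⟩ := ih x' hzx.lt x j hxx (hj.1 (by simp))
    have hjk : j ≤ k := hk.1 (by simp)
    have hyj : y' ≤ j := hj.1 (by simp)
    obtain ⟨m, hm⟩ := ih y' hzy.lt k y (hyj.trans hjk) hyy
    refine ⟨m, ?_, fun b hb => hm.2 ?_⟩
    · rintro _ (rfl | rfl)
      · exact (hk.1 (by simp)).trans (hm.1 (by simp))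
      · exact hm.1 (by simp)
    · have hxb : x ≤ b := hb (by simp)
      have hyb : y ≤ b := hb (by simp)
      have hjb : j ≤ b := hj.2 <| by
        rintro _ (rfl | rfl)
        exacts [hxx.trans hxb, hyy.trans hyb]
      rintro _ (rfl | rfl)
      · refine hk.2 ?_
        rintro _ (rfl | rfl)
        exacts [hxb, hjb]
      · exact hyb

theorem exists_lattice_of_covBy {X : Type*} [P : PartialOrder X] [Finite X] (b : X)
    (hb : ∀ x : X, b ≤ x)
    (hcov : ∀ z x y : X, z ⋖ x → z ⋖ y → ∃ j, IsLUB {x, y} j) :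
    ∃ L : Lattice X, L.toPartialOrder = P := by
  have hsup : ∀ x y : X, ∃ j, IsLUB {x, y} j := fun x y =>
    exists_isLUB_of_covBy hcov b x y (hb x) (hb y)
  have hset : ∀ s : Set X, ∃ j, IsLUB s j := fun s => by
    induction s, s.toFinite using Set.Finite.induction_on with
    | empty => exact ⟨b, by simp [isLUB_empty_iff, IsBot, hb]⟩
    | @insert x s _ _ ih =>
      obtain ⟨j, hj⟩ := ih
      obtain ⟨k, hk⟩ := hsup x j
      refine ⟨k, ?_, fun c hc => hk.2 ?_⟩
      · rintro y (rfl | hy)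
        · exact hk.1 (by simp)
        · exact (hj.1 hy).trans (hk.1 (by simp))
      · rintro _ (rfl | rfl)
        · exact hc (by simp)
        · exact hj.2 fun y hy => hc (by simp [hy])
  -- A meet is the join of all common lower bounds.
  have hinf : ∀ x y : X, ∃ j, IsGLB {x, y} j := fun x y => by
    obtain ⟨j, hj⟩ := hset (lowerBounds {x, y})
    exact ⟨j, isLUB_lowerBounds.1 hj⟩
  choose sup hsup using hsup
  choose inf hinf using hinf
  exact ⟨{ P with
    sup := sup
    inf := inf
    le_sup_left := fun x y => (hsup x y).1 (by simp)
    le_sup_right := fun x y => (hsup x y).1 (by simp)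
    sup_le := fun x y z hx hy => (hsup x y).2 (by rintro _ (rfl | rfl) <;> assumption)
    inf_le_left := fun x y => (hinf x y).1 (by simp)
    inf_le_right := fun x y => (hinf x y).1 (by simp)
    le_inf := fun x y z hx hy => (hinf y z).2 (by rintro _ (rfl | rfl) <;> assumption) }, rfl⟩

namespace IsBasis

variable {W : Subgroup (V ≃ₗᵢ[ℝ] V)} {Φ Δ : Set V} {a : V}

/-! ### Joins of covers of a common element -/

theorem inversions_mul_subset (h : IsBasis W Φ a Δ)
    {w s : W} {α : V} (hα : α ∈ Δ) (hs : s.1 = reflAlong α) :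
    inversions Φ a (w * s) ⊆ insert (w.1 α) (inversions Φ a w) := by
  rcases (h.regular _ (h.map_mem w (h.subset hα))).lt_or_gt with h0 | h0
  · have := h.inversions_mul (w := w * s) hα hs (by
      rw [coe_mul_apply, hs, reflAlong_self, map_neg, inner_neg_right]; linarith)
    rw [mul_assoc, mul_self_of_eq_reflAlong hs, mul_one] at this
    rw [this]
    exact (Set.subset_insert _ _).trans (Set.subset_insert _ _)
  · rw [h.inversions_mul hα hs h0]

/-- A negative coefficient at one simple root, moved to the other side, would by extremality make
the two simple roots proportional. -/
theorem mem_hull_pair (h : IsBasis W Φ a Δ)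
    {α β γ : V} (hα : α ∈ Δ) (hβ : β ∈ Δ) (hne : α ≠ β) (hγ : γ ∈ Φ)
    (hpos : 0 < ⟪a, γ⟫) (hspan : γ ∈ Submodule.span ℝ {α, β}) :
    γ ∈ PointedCone.hull ℝ {α, β} := by
  have key : ∀ α ∈ Δ, ∀ β ∈ Δ, α ≠ β → ∀ p q : ℝ, γ = p • α + q • β → 0 ≤ q := by
    intro α hα β hβ hne p q hpq
    by_contra! hq
    obtain ⟨t, ht⟩ := h.extremal α hα ((-q) • β)
      (PointedCone.smul_mem _ (by linarith) (PointedCone.subset_hull hβ)) γ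
      (h.mem_hull γ hγ hpos) p (by rw [hpq, neg_smul]; abel)
    have hβt : β = ((-q)⁻¹ * t) • α := by
      rw [← smul_smul, ← ht, smul_smul, inv_mul_cancel₀ (by linarith), one_smul]
    have := h.eq_or_eq_neg α (h.subset hα) ((-q)⁻¹ * t) (hβt ▸ h.subset hβ)
    rw [← hβt] at this
    rcases this with rfl | rfl
    · exact hne rfl
    · have h1 := h.pos _ hβ
      rw [inner_neg_right] at h1
      linarith [h.pos _ hα]
  obtain ⟨p, q, hpq⟩ := Submodule.mem_span_pair.1 hspan
  have hq := key α hα β hβ hne p q hpq.symm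
  have hp := key β hβ α hα hne.symm q p (by rw [← hpq, add_comm])
  rw [← hpq]
  exact Submodule.add_mem _ (PointedCone.smul_mem _ hp (PointedCone.subset_hull (by simp)))
    (PointedCone.smul_mem _ hq (PointedCone.subset_hull (by simp)))

/-- Multiplying `w` by a letter can add only the inversion `w δ`, which lies in the span because `w`
moves vectors only along it; hence the two claims are proved together. -/
theorem inversions_subset_span (h : IsBasis W Φ a Δ) {α β : V} (hα : α ∈ Δ) (hβ : β ∈ Δ) {s t : W}
    (hs : s.1 = reflAlong α) (ht : t.1 = reflAlong β) {w : W}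
    (hw : w ∈ Subgroup.closure {s, t}) :
    (∀ x, w.1 x - x ∈ Submodule.span ℝ {α, β}) ∧
      inversions Φ a w ⊆ Submodule.span ℝ {α, β} := by
  have step : ∀ r : W, ∀ δ ∈ Δ, δ ∈ Submodule.span ℝ {α, β} → r.1 = reflAlong δ → ∀ w : W,
      ((∀ x, w.1 x - x ∈ Submodule.span ℝ {α, β}) ∧
        inversions Φ a w ⊆ Submodule.span ℝ {α, β}) →
      ((∀ x, (w * r).1 x - x ∈ Submodule.span ℝ {α, β}) ∧
        inversions Φ a (w * r) ⊆ Submodule.span ℝ {α, β}) := by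
    rintro r δ hδ hmem hr w ⟨h1, h2⟩
    refine ⟨fun x => ?_, (h.inversions_mul_subset hδ hr).trans (Set.insert_subset ?_ h2)⟩
    · have h3 : r.1 x - x ∈ Submodule.span ℝ {α, β} := by
        rw [hr, reflAlong_apply, sub_sub_cancel_left]
        exact Submodule.neg_mem _ (Submodule.smul_mem _ _ hmem)
      have := Submodule.add_mem _ (h1 (r.1 x)) h3
      rwa [sub_add_sub_cancel] at this
    · have := Submodule.add_mem _ (h1 δ) hmem
      rwa [sub_add_cancel] at this
  have hαm : α ∈ Submodule.span ℝ {α, β} := Submodule.subset_span (by simp)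
  have hβm : β ∈ Submodule.span ℝ {α, β} := Submodule.subset_span (by simp)
  have step' : ∀ r ∈ ({s, t} : Set W), r⁻¹ = r ∧ ∃ δ ∈ Δ, δ ∈ Submodule.span ℝ {α, β} ∧
      r.1 = reflAlong δ := by
    rintro _ (rfl | rfl)
    · exact ⟨inv_eq_of_mul_eq_one_left (mul_self_of_eq_reflAlong hs), α, hα, hαm, hs⟩
    · exact ⟨inv_eq_of_mul_eq_one_left (mul_self_of_eq_reflAlong ht), β, hβ, hβm, ht⟩
  induction hw using Subgroup.closure_induction_right with
  | one => exact ⟨fun x => by simp, by simp [inversions_one]⟩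
  | mul_right x _ r hr ih =>
    obtain ⟨-, δ, hδ, hm, hrδ⟩ := step' r hr
    exact step r δ hδ hm hrδ x ih
  | mul_inv_cancel x _ r hr ih =>
    obtain ⟨hinv, δ, hδ, hm, hrδ⟩ := step' r hr
    rw [hinv]
    exact step r δ hδ hm hrδ x ih

/-- Let `z` have most inversions in `⟨s, t⟩`; then `z` makes both `α` and `β` negative, and the join
is `u * z⁻¹`. Inversions of `z⁻¹` lie in the cone of `α` and `β`, so those which `u * z⁻¹` adds to
`u` lie in the cone of `u α` and `u β`, both inverted by any upper bound `v`. -/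
theorem exists_join_mul (h : IsBasis W Φ a Δ)
    [Finite W] (u : W) {α β : V} (hα : α ∈ Δ) (hβ : β ∈ Δ) (hne : α ≠ β)
    {s t : W} (hs : s.1 = reflAlong α) (ht : t.1 = reflAlong β) (hu : 0 < ⟪a, u.1 α⟫)
    (hu' : 0 < ⟪a, u.1 β⟫) :
    ∃ y : W, inversions Φ a (u * s) ⊆ inversions Φ a y ∧ inversions Φ a (u * t) ⊆ inversions Φ a y ∧
      ∀ v : W, inversions Φ a (u * s) ⊆ inversions Φ a v →
        inversions Φ a (u * t) ⊆ inversions Φ a v → inversions Φ a y ⊆ inversions Φ a v := by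
  obtain ⟨z, hz, hmax⟩ := Set.exists_max_image (Subgroup.closure {s, t} : Set W)
    (fun w => (inversions Φ a w).ncard) (Set.toFinite _) ⟨1, Subgroup.one_mem _⟩
  have hneg : ∀ r ∈ ({s, t} : Set W), ∀ δ ∈ Δ, r.1 = reflAlong δ → ⟪a, z.1 δ⟫ < 0 := by
    intro r hr δ hδ hrδ
    refine (h.regular _ (h.map_mem z (h.subset hδ))).lt_or_gt.resolve_right fun h0 => ?_
    have h1 := h.ncard_inversions_mul hδ hrδ h0
    have h2 := hmax (z * r) (Subgroup.mul_mem _ hz (Subgroup.subset_closure hr))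
    omega
  have hcone : ∀ γ ∈ inversions Φ a z⁻¹, ∀ c : V, 0 < ⟪c, α⟫ → 0 < ⟪c, β⟫ → 0 < ⟪c, γ⟫ := by
    intro γ hγ c h1 h2
    have hspan := (h.inversions_subset_span hα hβ hs ht (Subgroup.inv_mem _ hz)).2 hγ
    refine (eq_zero_or_inner_pos_of_mem_hull ?_
      (h.mem_hull_pair hα hβ hne hγ.1 hγ.2.1 hspan)).resolve_left (h.ne_zero γ hγ.1)
    rintro _ (rfl | rfl) <;> assumption
  -- A lost inversion `γ` would put `-u⁻¹ γ` in the cone of `α` and `β`, where `u⁻¹ a` is positive,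
  -- contradicting `⟪a, γ⟫ > 0`.
  have hinv : inversions Φ a u ⊆ inversions Φ a (u * z⁻¹) := by
    intro γ hγ
    refine ⟨hγ.1, hγ.2.1, (h.apply_regular _ hγ.1).lt_or_gt.resolve_right fun h0 => ?_⟩
    have hmem : -u⁻¹.1 γ ∈ inversions Φ a z⁻¹ := by
      refine ⟨h.neg_mem (h.map_mem _ hγ.1), ?_, ?_⟩
      · rw [inner_neg_right, ← inner_apply_left]
        linarith [hγ.2.2]
      · rw [coe_mul_apply, inner_apply_left u] at h0
        rw [inner_neg_right]
        linarith
    have := hcone _ hmem (u⁻¹.1 a) (by rwa [inner_apply_left, inv_inv])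
      (by rwa [inner_apply_left, inv_inv])
    rw [inner_neg_right, LinearIsometryEquiv.inner_map_map] at this
    linarith [hγ.2.1]
  have hmem : ∀ r ∈ ({s, t} : Set W), ∀ δ ∈ Δ, r.1 = reflAlong δ → 0 < ⟪a, u.1 δ⟫ →
      inversions Φ a (u * r) ⊆ inversions Φ a (u * z⁻¹) := by
    intro r hr δ hδ hrδ h0
    rw [h.inversions_mul hδ hrδ h0]
    refine Set.insert_subset ⟨h.map_mem u (h.subset hδ), h0, ?_⟩ hinv
    rw [coe_mul_apply, LinearIsometryEquiv.inner_map_map, inner_apply_left, inv_inv]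
    exact hneg r hr δ hδ hrδ
  refine ⟨u * z⁻¹, hmem s (by simp) α hα hs hu, hmem t (by simp) β hβ ht hu', ?_⟩
  intro v hv hv' γ hγ
  rw [h.inversions_mul hα hs hu] at hv
  rw [h.inversions_mul hβ ht hu'] at hv'
  rcases (h.apply_regular u hγ.1).lt_or_gt with h0 | h0
  · exact hv (Set.mem_insert_of_mem _ ⟨hγ.1, hγ.2.1, h0⟩)
  · have hmem : u⁻¹.1 γ ∈ inversions Φ a z⁻¹ := by
      refine ⟨h.map_mem _ hγ.1, by rwa [← inner_apply_left], ?_⟩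
      rw [← inner_apply_left]
      exact hγ.2.2
    have hc : ∀ δ, u.1 δ ∈ inversions Φ a v → 0 < ⟪-u⁻¹.1 (v.1 a), δ⟫ := fun δ hδ => by
      rw [inner_neg_left, inner_apply_left, inv_inv, neg_pos]
      exact hδ.2.2
    have := hcone _ hmem (-u⁻¹.1 (v.1 a)) (hc α (hv (Set.mem_insert _ _)))
      (hc β (hv' (Set.mem_insert _ _)))
    rw [inner_neg_left, LinearIsometryEquiv.inner_map_map] at this
    exact ⟨hγ.1, hγ.2.1, by linarith⟩

/-! ### The weak order -/

/-- Cross a wall of the chamber of `u a` towards `v a`. The crossing goes up, since otherwise `-u α`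
would be an inversion of `u` but not of `v`. -/
theorem exists_mul_subset (h : IsBasis W Φ a Δ)
    {u v : W} (hle : inversions Φ a u ⊆ inversions Φ a v) (hne : u ≠ v) :
    ∃ α ∈ Δ, ∃ s : W, s.1 = reflAlong α ∧ 0 < ⟪a, u.1 α⟫ ∧
      inversions Φ a (u * s) ⊆ inversions Φ a v := by
  obtain ⟨α, hα, hneg⟩ := h.exists_inner_neg (u := u) (v := v) fun h0 =>
    hne (inv_mul_eq_one.1 (h.eq_one_of_inversions_eq_empty h0))
  obtain ⟨s, hs, -⟩ := h.exists_simple hα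
  have hmem := h.map_mem u (h.subset hα)
  have hpos : 0 < ⟪a, u.1 α⟫ := by
    refine (h.regular _ hmem).lt_or_gt.resolve_left fun h0 => ?_
    have := (hle (a := -u.1 α) ⟨h.neg_mem hmem, by rwa [inner_neg_right, neg_pos], by
      rw [inner_neg_right, LinearIsometryEquiv.inner_map_map]; linarith [h.pos α hα]⟩).2.2
    rw [inner_neg_right] at this
    linarith
  refine ⟨α, hα, s, hs, hpos, ?_⟩
  rw [h.inversions_mul hα hs hpos]
  exact Set.insert_subset ⟨hmem, hpos, hneg⟩ hle

theorem lt_mul (h : IsBasis W Φ a Δ) [PartialOrder W]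
    (hle : ∀ u v : W, u ≤ v ↔ inversions Φ a u ⊆ inversions Φ a v) {u s : W} {α : V} (hα : α ∈ Δ)
    (hs : s.1 = reflAlong α) (hpos : 0 < ⟪a, u.1 α⟫) : u < u * s := by
  refine lt_of_le_of_ne ?_ ?_
  · rw [hle, h.inversions_mul hα hs hpos]
    exact Set.subset_insert _ _
  · intro heq
    have := h.ncard_inversions_mul hα hs hpos
    rw [← heq] at this
    omega

theorem exists_eq_mul_of_covBy (h : IsBasis W Φ a Δ) [PartialOrder W]
    (hle : ∀ u v : W, u ≤ v ↔ inversions Φ a u ⊆ inversions Φ a v) {u v : W} (huv : u ⋖ v) :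
    ∃ α ∈ Δ, ∃ s : W, s.1 = reflAlong α ∧ 0 < ⟪a, u.1 α⟫ ∧ v = u * s := by
  obtain ⟨α, hα, s, hs, hpos, hsub⟩ := h.exists_mul_subset ((hle u v).1 huv.le) huv.lt.ne
  refine ⟨α, hα, s, hs, hpos, ?_⟩
  exact (eq_of_le_of_not_lt ((hle _ _).2 hsub) (huv.2 (h.lt_mul hle hα hs hpos))).symm

theorem exists_lattice (h : IsBasis W Φ a Δ) [Finite W] :
    ∃ _ : Lattice W, ∀ u v : W, u ≤ v ↔ inversions Φ a u ⊆ inversions Φ a v := by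
  let P : PartialOrder W := PartialOrder.lift (inversions Φ a) h.inversions_injective
  have hle : ∀ u v : W, u ≤ v ↔ inversions Φ a u ⊆ inversions Φ a v := fun _ _ => Iff.rfl
  obtain ⟨L, hL⟩ := exists_lattice_of_covBy (X := W) 1 (fun w => by
    rw [hle, inversions_one]; exact Set.empty_subset _) (by
    intro z x y hx hy
    by_cases hxy : x = y
    · exact ⟨x, by rw [← hxy, Set.pair_eq_singleton]; exact isLUB_singleton⟩
    obtain ⟨α, hα, s, hs, hzα, rfl⟩ := h.exists_eq_mul_of_covBy hle hx
    obtain ⟨β, hβ, t, ht, hzβ, rfl⟩ := h.exists_eq_mul_of_covBy hle hy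
    have hne : α ≠ β := by
      rintro rfl
      exact hxy (by rw [Subtype.ext (hs.trans ht.symm)])
    obtain ⟨j, h1, h2, h3⟩ := h.exists_join_mul z hα hβ hne hs ht hzα hzβ
    refine ⟨j, ?_, fun b hb => h3 b (hb (by simp)) (hb (by simp))⟩
    rintro _ (rfl | rfl) <;> assumption)
  refine ⟨L, fun u v => ?_⟩
  rw [← hle, ← hL]

/-- An element with most inversions makes every simple root negative, hence every positive root. -/
theorem exists_longest (h : IsBasis W Φ a Δ) [Finite W] :
    ∃ w : W, ∀ β ∈ Φ, 0 < ⟪a, β⟫ → β ∈ inversions Φ a w := by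
  obtain ⟨w, -, hmax⟩ := Set.exists_max_image (Set.univ : Set W)
    (fun w => (inversions Φ a w).ncard) (Set.toFinite _) ⟨1, trivial⟩
  refine ⟨w, fun β hβ hpos => ⟨hβ, hpos, ?_⟩⟩
  have hneg : ∀ δ ∈ Δ, 0 < ⟪-w⁻¹.1 a, δ⟫ := fun δ hδ => by
    obtain ⟨s, hs, -⟩ := h.exists_simple hδ
    rw [inner_neg_left, neg_pos, inner_apply_left, inv_inv]
    refine (h.regular _ (h.map_mem w (h.subset hδ))).lt_or_gt.resolve_right fun h0 => ?_
    have h1 := h.ncard_inversions_mul hδ hs h0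
    have h2 := hmax (w * s) trivial
    omega
  refine (h.apply_regular w hβ).lt_or_gt.resolve_right fun h0 => ?_
  rw [inner_apply_left] at h0
  have := inner_nonneg_of_mem_hull (fun δ hδ => (hneg δ hδ).le)
    (h.mem_hull _ (h.map_mem w⁻¹ hβ) h0)
  rw [inner_neg_left, LinearIsometryEquiv.inner_map_map] at this
  linarith

end IsBasis

/-! ### Faces of the convex hull of a finite family -/

theorem toExposed_convexHull_range {ι : Type*} [Finite ι] [Nonempty ι] (p : ι → V)
    (l : StrongDual ℝ V) :
    l.toExposed (convexHull ℝ (Set.range p)) =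
      convexHull ℝ (p '' {i | ∀ j, l (p j) ≤ l (p i)}) := by
  obtain ⟨i₀, hi₀⟩ := Finite.exists_max fun i => l (p i)
  have hle : ∀ y ∈ convexHull ℝ (Set.range p), l y ≤ l (p i₀) := by
    refine convexHull_min ?_ (convex_halfSpace_le l.isLinear _)
    rintro _ ⟨i, rfl⟩
    exact hi₀ i
  apply subset_antisymm
  · rintro x ⟨hx, hmax⟩
    -- This set is convex: a proper convex combination attains the maximum of `l` only if both
    -- endpoints do.
    have hsub : convexHull ℝ (Set.range p) ⊆ {x | l x ≤ l (p i₀) ∧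
        (l x = l (p i₀) → x ∈ convexHull ℝ (p '' {i | ∀ j, l (p j) ≤ l (p i)}))} := by
      refine convexHull_min ?_ ?_
      · rintro _ ⟨i, rfl⟩
        refine ⟨hi₀ i, fun heq => subset_convexHull ℝ _ ⟨i, fun j => ?_, rfl⟩⟩
        rw [heq]
        exact hi₀ j
      · rw [convex_iff_forall_pos]
        rintro x ⟨hx, hx'⟩ y ⟨hy, hy'⟩ s t hs ht hst
        have hl : l (s • x + t • y) = s * l x + t * l y := by simp
        have hM : l (p i₀) = s * l (p i₀) + t * l (p i₀) := by rw [← add_mul, hst, one_mul]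
        refine ⟨?_, fun heq => ?_⟩
        · rw [hl, hM]
          gcongr
        · rw [hl] at heq
          have h1 : l x = l (p i₀) := le_antisymm hx (by nlinarith)
          have h2 : l y = l (p i₀) := le_antisymm hy (by nlinarith)
          exact convex_convexHull ℝ _ (hx' h1) (hy' h2) hs.le ht.le hst
    exact (hsub hx).2 (le_antisymm (hle x hx) (hmax _ (subset_convexHull ℝ _ ⟨i₀, rfl⟩)))
  · refine convexHull_min ?_
      (ContinuousLinearMap.toExposed.isExposed.convex (convex_convexHull ℝ _))
    rintro _ ⟨i, hi, rfl⟩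
    exact ⟨subset_convexHull ℝ _ ⟨i, rfl⟩, fun y hy => (hle y hy).trans (hi i₀)⟩

/-- The elements `w` for which `w a` lies on the face of the permutahedron in direction `c`. -/
def maximizers (W : Subgroup (V ≃ₗᵢ[ℝ] V)) (a c : V) : Set W :=
  {w | ∀ w' : W, ⟪c, w'.1 a⟫ ≤ ⟪c, w.1 a⟫}

theorem maximizers_nonempty (W : Subgroup (V ≃ₗᵢ[ℝ] V)) [Finite W] (a c : V) :
    (maximizers W a c).Nonempty :=
  Finite.exists_max fun w : W => ⟪c, w.1 a⟫

theorem isFace_maximizers (W : Subgroup (V ≃ₗᵢ[ℝ] V)) [Finite W] (a c : V) :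
    IsFace (perm W a) (convexHull ℝ ((fun w : W => w.1 a) '' maximizers W a c)) := by
  refine ⟨((maximizers_nonempty W a c).image _).convexHull, ?_⟩
  rw [show maximizers W a c = {w | ∀ w' : W, innerSL ℝ c (w'.1 a) ≤ innerSL ℝ c (w.1 a)} from rfl,
    ← toExposed_convexHull_range]
  exact ContinuousLinearMap.toExposed.isExposed

theorem IsFace.exists_maximizers [FiniteDimensional ℝ V] {W : Subgroup (V ≃ₗᵢ[ℝ] V)} [Finite W]
    {a : V} {F : Set V} (hF : IsFace (perm W a) F) :
    ∃ c : V, F = convexHull ℝ ((fun w : W => w.1 a) '' maximizers W a c) ∧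
      {w : W | w.1 a ∈ F} = maximizers W a c := by
  obtain ⟨hne, hexp⟩ := hF
  obtain ⟨l, hl⟩ := hexp hne
  have hlc : ∀ x, l x = ⟪(InnerProductSpace.toDual ℝ V).symm l, x⟫ := fun x =>
    InnerProductSpace.toDual_symm_apply.symm
  have hF' : F = l.toExposed (convexHull ℝ (Set.range fun w : W => w.1 a)) := hl
  refine ⟨(InnerProductSpace.toDual ℝ V).symm l, ?_, ?_⟩
  · rw [hF', toExposed_convexHull_range]
    simp only [hlc]
    rfl
  · refine subset_antisymm (fun w hw w' => ?_) fun w hw => ?_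
    · rw [← hlc, ← hlc]
      have hw : w.1 a ∈ F := hw
      rw [hF'] at hw
      exact hw.2 _ (subset_convexHull ℝ _ ⟨w', rfl⟩)
    · change w.1 a ∈ F
      rw [hF', toExposed_convexHull_range]
      refine subset_convexHull ℝ _ ⟨w, fun w' => ?_, rfl⟩
      rw [hlc, hlc]
      exact hw w'

theorem exists_perturbation {Φ : Set V} (hΦ : Φ.Finite) (a c : V) :
    ∃ ε : ℝ, 0 < ε ∧ ∀ β ∈ Φ, 0 < ⟪c, β⟫ → 0 < ⟪c + ε • a, β⟫ ∧ 0 < ⟪c - ε • a, β⟫ := by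
  have hev : ∀ᶠ ε in nhdsWithin (0 : ℝ) (Set.Ioi 0), ∀ β ∈ Φ, 0 < ⟪c, β⟫ →
      0 < ⟪c + ε • a, β⟫ ∧ 0 < ⟪c - ε • a, β⟫ := by
    refine Filter.Eventually.filter_mono nhdsWithin_le_nhds ?_
    rw [Filter.eventually_all_finite hΦ]
    intro β _
    by_cases h0 : 0 < ⟪c, β⟫
    · have h1 : ContinuousAt (fun ε : ℝ => ⟪c + ε • a, β⟫) 0 := by fun_prop
      have h2 : ContinuousAt (fun ε : ℝ => ⟪c - ε • a, β⟫) 0 := by fun_prop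
      filter_upwards [h1.eventually_const_lt (u := 0) (by simpa using h0),
        h2.eventually_const_lt (u := 0) (by simpa using h0)] with ε h3 h4 _
      exact ⟨h3, h4⟩
    · exact Filter.Eventually.of_forall fun _ h' => absurd h' h0
  obtain ⟨ε, h1, h2⟩ := (hev.and self_mem_nhdsWithin).exists
  exact ⟨ε, h2, h1⟩

namespace IsBasis

variable {W : Subgroup (V ≃ₗᵢ[ℝ] V)} {Φ Δ : Set V} {a : V}

/-! ### Maximizers of a linear functional on the orbit -/

/-- Otherwise reflecting `w a` in `β` would increase `⟪c, ·⟫`. -/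
theorem inner_pos_of_mem_maximizers (h : IsBasis W Φ a Δ)
    {c : V} {w : W} (hw : w ∈ maximizers W a c) {β : V}
    (hβ : β ∈ Φ) (hc : 0 < ⟪c, β⟫) : 0 < ⟪w.1 a, β⟫ := by
  refine (h.apply_regular w hβ).lt_or_gt.resolve_left fun hlt => ?_
  have hmax := hw (⟨reflAlong β, reflAlong_mem h.closure_eq hβ⟩ * w)
  rw [coe_mul_apply, reflAlong_apply, inner_sub_right, inner_smul_right] at hmax
  have h1 : 2 * ⟪β, w.1 a⟫ / ⟪β, β⟫ < 0 :=
    div_neg_of_neg_of_pos (by rw [real_inner_comm]; linarith)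
      (real_inner_self_pos.2 (h.ne_zero β hβ))
  nlinarith

/-- Walk from `w a` to `v a` across separating walls. The sign conditions on both ends force each
wall root to be orthogonal to `c`, so the reflection fixes `c` and preserves both the value and the
sign condition. -/
theorem inner_eq_of_inner_pos (h : IsBasis W Φ a Δ)
    {c : V} {v : W} (hv : ∀ β ∈ Φ, 0 < ⟪c, β⟫ → 0 < ⟪v.1 a, β⟫) {w : W}
    (hw : ∀ β ∈ Φ, 0 < ⟪c, β⟫ → 0 < ⟪w.1 a, β⟫) : ⟪c, w.1 a⟫ = ⟪c, v.1 a⟫ := by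
  induction hn : (inversions Φ a (v⁻¹ * w)).ncard using Nat.strong_induction_on generalizing w with
  | _ n ih =>
    by_cases hwv : w = v
    · rw [hwv]
    obtain ⟨α, hα, hneg⟩ := h.exists_inner_neg (u := w) (v := v) fun h0 =>
      hwv (inv_mul_eq_one.1 (h.eq_one_of_inversions_eq_empty h0))
    obtain ⟨s, hs, -⟩ := h.exists_simple hα
    have hmem := h.map_mem w (h.subset hα)
    have horth : ⟪c, w.1 α⟫ = 0 := by
      rcases lt_trichotomy ⟪c, w.1 α⟫ 0 with h0 | h0 | h0
      · have := hw _ (h.neg_mem hmem) (by rwa [inner_neg_right, neg_pos])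
        rw [inner_neg_right, LinearIsometryEquiv.inner_map_map] at this
        linarith [h.pos α hα]
      · exact h0
      · exact absurd (hv _ hmem h0) hneg.not_gt
    have hfix : reflAlong (w.1 α) c = c := by
      rw [reflAlong_apply, real_inner_comm, horth]
      simp
    have hws : ∀ x, (w * s).1 x = reflAlong (w.1 α) (w.1 x) := fun x => by
      rw [Subgroup.coe_mul, hs, ← reflAlong_map]
      rfl
    have hcard := h.ncard_inversions_of_neg (w := v⁻¹ * w) hα hs (by
      rw [coe_mul_apply, ← inner_apply_left]; exact hneg)
    rw [mul_assoc] at hcard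
    rw [← ih _ (by omega) (w := w * s) ?_ rfl, hws, ← inner_reflAlong, hfix]
    intro β hβ hcβ
    rw [hws, inner_reflAlong]
    exact hw _ (h.reflAlong_mem_root hmem hβ) (by rwa [← inner_reflAlong, hfix])

theorem mem_maximizers_iff (h : IsBasis W Φ a Δ) [Finite W] {c : V} {w : W} :
    w ∈ maximizers W a c ↔ ∀ β ∈ Φ, 0 < ⟪c, β⟫ → 0 < ⟪w.1 a, β⟫ := by
  refine ⟨fun hw β hβ hc => h.inner_pos_of_mem_maximizers hw hβ hc, fun hw w' => ?_⟩
  obtain ⟨v, hv⟩ := maximizers_nonempty W a c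
  rw [h.inner_eq_of_inner_pos (fun β hβ hc => h.inner_pos_of_mem_maximizers hv hβ hc) hw]
  exact hv w'

/-- The ends `u` and `v` maximize `c + ε • a` and `c - ε • a`. Both satisfy the sign condition of
`c`; among the positive roots orthogonal to `c`, `u` inverts none and `v` inverts all. -/
theorem exists_maximizers_eq_Icc (h : IsBasis W Φ a Δ) [Finite W] [PartialOrder W]
    (hle : ∀ u v : W, u ≤ v ↔ inversions Φ a u ⊆ inversions Φ a v) (c : V) :
    ∃ u v : W, u ≤ v ∧ maximizers W a c = Set.Icc u v := by
  obtain ⟨ε, hε, hpert⟩ := exists_perturbation h.finite a c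
  obtain ⟨u, hu⟩ := maximizers_nonempty W a (c + ε • a)
  obtain ⟨v, hv⟩ := maximizers_nonempty W a (c - ε • a)
  rw [h.mem_maximizers_iff] at hu hv
  have hu1 : ∀ β ∈ Φ, 0 < ⟪c, β⟫ → 0 < ⟪u.1 a, β⟫ := fun β hβ hc => hu β hβ (hpert β hβ hc).1
  have hv1 : ∀ β ∈ Φ, 0 < ⟪c, β⟫ → 0 < ⟪v.1 a, β⟫ := fun β hβ hc => hv β hβ (hpert β hβ hc).2
  have hu2 : ∀ β ∈ Φ, ⟪c, β⟫ = 0 → 0 < ⟪a, β⟫ → 0 < ⟪u.1 a, β⟫ := fun β hβ hc ha => hu β hβ (by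
    rw [inner_add_left, hc, real_inner_smul_left, zero_add]
    positivity)
  have hv2 : ∀ β ∈ Φ, ⟪c, β⟫ = 0 → 0 < ⟪a, β⟫ → ⟪v.1 a, β⟫ < 0 := fun β hβ hc ha => by
    have := hv (-β) (h.neg_mem hβ) (by
      rw [inner_neg_right, inner_sub_left, hc, real_inner_smul_left, zero_sub, neg_neg]
      positivity)
    rwa [inner_neg_right, neg_pos] at this
  have hneg : ∀ w : W, (∀ β ∈ Φ, 0 < ⟪c, β⟫ → 0 < ⟪w.1 a, β⟫) → ∀ β ∈ Φ, ⟪c, β⟫ < 0 →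
      ⟪w.1 a, β⟫ < 0 := fun w hw β hβ hc => by
    have := hw (-β) (h.neg_mem hβ) (by rwa [inner_neg_right, neg_pos])
    rwa [inner_neg_right, neg_pos] at this
  have heq : maximizers W a c = Set.Icc u v := by
    ext w
    rw [h.mem_maximizers_iff, Set.mem_Icc, hle, hle]
    refine ⟨fun hw => ⟨fun β hβ => ?_, fun β hβ => ?_⟩, fun hw β hβ hc => ?_⟩
    · obtain ⟨hβΦ, hpos, hlt⟩ := hβ
      rcases lt_trichotomy ⟪c, β⟫ 0 with h0 | h0 | h0
      · exact ⟨hβΦ, hpos, hneg w hw β hβΦ h0⟩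
      · exact absurd (hu2 β hβΦ h0 hpos) hlt.not_gt
      · exact absurd (hu1 β hβΦ h0) hlt.not_gt
    · obtain ⟨hβΦ, hpos, hlt⟩ := hβ
      rcases lt_trichotomy ⟪c, β⟫ 0 with h0 | h0 | h0
      · exact ⟨hβΦ, hpos, hneg v hv1 β hβΦ h0⟩
      · exact ⟨hβΦ, hpos, hv2 β hβΦ h0 hpos⟩
      · exact absurd (hw β hβΦ h0) hlt.not_gt
    · rcases (h.regular β hβ).lt_or_gt with h0 | h0
      · have := (hw.1 (show -β ∈ inversions Φ a u from ⟨h.neg_mem hβ, by rwa [inner_neg_right, neg_pos], by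
          rw [inner_neg_right, Left.neg_neg_iff]; exact hu1 β hβ hc⟩)).2.2
        rwa [inner_neg_right, Left.neg_neg_iff] at this
      · refine (h.apply_regular w hβ).lt_or_gt.resolve_left fun hlt => ?_
        exact (hw.2 ⟨hβ, h0, hlt⟩).2.2.not_gt (hv1 β hβ hc)
  have hmem : u ∈ maximizers W a c := h.mem_maximizers_iff.2 hu1
  rw [heq] at hmem
  exact ⟨u, v, hmem.2, heq⟩

/-! ### Vertices and edges -/

theorem maximizers_apply (h : IsBasis W Φ a Δ)
    [Finite W] (w : W) : maximizers W a (w.1 a) = {w} := by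
  ext v
  rw [h.mem_maximizers_iff, Set.mem_singleton_iff]
  refine ⟨fun hv => h.inversions_injective ?_, fun hv β _ hβ => hv ▸ hβ⟩
  ext β
  refine and_congr_right fun hβ => and_congr_right fun _ => ⟨fun hlt => ?_, fun hlt => ?_⟩
  · exact (h.apply_regular w hβ).lt_or_gt.resolve_right fun h0 => hlt.not_gt (hv β hβ h0)
  · have := hv (-β) (h.neg_mem hβ) (by rwa [inner_neg_right, neg_pos])
    rwa [inner_neg_right, neg_pos] at this

theorem apply_mem_exposedPoints (h : IsBasis W Φ a Δ)
    [Finite W] (w : W) : w.1 a ∈ (perm W a).exposedPoints ℝ := by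
  rw [mem_exposedPoints_iff_exposed_singleton]
  have := (isFace_maximizers W a (w.1 a)).2
  rwa [h.maximizers_apply, Set.image_singleton, convexHull_singleton] at this

theorem exists_equiv_exposedPoints (h : IsBasis W Φ a Δ) [Finite W] [FiniteDimensional ℝ V] :
    ∃ e : W ≃ (perm W a).exposedPoints ℝ, ∀ w : W, (e w : V) = w.1 a := by
  refine ⟨Equiv.ofBijective (fun w => ⟨w.1 a, h.apply_mem_exposedPoints w⟩) ⟨?_, ?_⟩, fun w => rfl⟩
  · intro u v huv
    refine h.inversions_injective ?_
    have huv : u.1 a = v.1 a := congrArg Subtype.val huv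
    simp only [inversions, huv]
  · rintro ⟨x, hx⟩
    rw [mem_exposedPoints_iff_exposed_singleton] at hx
    obtain ⟨c, -, hc⟩ := IsFace.exists_maximizers (W := W) ⟨Set.singleton_nonempty x, hx⟩
    obtain ⟨w, hw⟩ := maximizers_nonempty W a c
    rw [← hc] at hw
    exact ⟨w, Subtype.ext hw⟩

/-- Roots other than `±u α` have the same sign on `u a` and `(u * s) a`, hence on the sum, while `u
α` is orthogonal to it. So a maximizer `w` can differ from `u` only by the inversion `α` of `u⁻¹ *
w`. -/
theorem maximizers_add (h : IsBasis W Φ a Δ)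
    [Finite W] {u s : W} {α : V} (hα : α ∈ Δ) (hs : s.1 = reflAlong α) :
    maximizers W a (u.1 a + (u * s).1 a) = {u, u * s} := by
  have hsum : ∀ β, ⟪u.1 a + (u * s).1 a, β⟫ = ⟪a, u⁻¹.1 β⟫ + ⟪a, reflAlong α (u⁻¹.1 β)⟫ :=
    fun β => by
      rw [inner_add_left, coe_mul_apply, inner_apply_left, inner_apply_left, hs, inner_reflAlong]
  ext w
  rw [h.mem_maximizers_iff]
  constructor
  · intro hw
    have hsub : inversions Φ a (u⁻¹ * w) ⊆ {α} := by
      rintro β ⟨hβ, hpos, hlt⟩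
      by_contra hne
      have := hw (u.1 β) (h.map_mem u hβ) (by
        rw [hsum, inv_apply_apply]
        exact add_pos hpos (h.inner_reflAlong_pos hα hβ hpos hne))
      rw [coe_mul_apply, inner_apply_left, inv_inv] at hlt
      exact hlt.not_gt this
    have hinv : inversions Φ a s = {α} := by
      have := h.inversions_mul (w := 1) hα hs (h.pos α hα)
      rw [one_mul, inversions_one] at this
      rw [this]
      exact LawfulSingleton.insert_empty_eq α
    rcases Set.subset_singleton_iff_eq.1 hsub with h0 | h0
    · exact .inl (inv_mul_eq_one.1 (h.eq_one_of_inversions_eq_empty h0)).symm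
    · right
      rw [← h.inversions_injective (h0.trans hinv.symm), mul_inv_cancel_left]
      rfl
  · intro hw β hβ hpos
    rw [hsum] at hpos
    have hmem := h.map_mem u⁻¹ hβ
    have hiff : 0 < ⟪a, reflAlong α (u⁻¹.1 β)⟫ ↔ 0 < ⟪a, u⁻¹.1 β⟫ := by
      refine h.inner_reflAlong_pos_iff hα hmem (fun h0 => ?_) fun h0 => ?_
      · rw [h0, reflAlong_self, inner_neg_right, add_neg_cancel] at hpos
        exact hpos.false
      · rw [h0, map_neg, reflAlong_self, neg_neg, inner_neg_right, neg_add_cancel] at hpos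
        exact hpos.false
    have hpos' : 0 < ⟪a, u⁻¹.1 β⟫ := by
      by_contra hcon
      linarith [not_lt.1 (mt hiff.1 hcon), not_lt.1 hcon]
    rcases hw with rfl | rfl
    · rwa [inner_apply_left]
    · rw [coe_mul_apply, inner_apply_left, hs, inner_reflAlong]
      exact hiff.2 hpos'

theorem isEdge_of_covBy (h : IsBasis W Φ a Δ) [Finite W] [PartialOrder W]
    (hle : ∀ u v : W, u ≤ v ↔ inversions Φ a u ⊆ inversions Φ a v) {u v : W} (huv : u ⋖ v) :
    IsEdge (perm W a) (segment ℝ (u.1 a) (v.1 a)) := by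
  obtain ⟨α, hα, s, hs, -, rfl⟩ := h.exists_eq_mul_of_covBy hle huv
  refine ⟨?_, ?_⟩
  · have := isFace_maximizers W a (u.1 a + (u * s).1 a)
    rwa [h.maximizers_add hα hs, Set.image_pair, convexHull_pair] at this
  · rw [vectorSpan_segment]
    refine finrank_span_singleton (sub_ne_zero.2 fun heq => huv.lt.ne' (h.inversions_injective ?_))
    simp only [inversions, heq]

theorem covBy_or_covBy_of_isEdge (h : IsBasis W Φ a Δ)
    [Finite W] [FiniteDimensional ℝ V] [PartialOrder W]
    (hle : ∀ u v : W, u ≤ v ↔ inversions Φ a u ⊆ inversions Φ a v) {u v : W}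
    (huv : IsEdge (perm W a) (segment ℝ (u.1 a) (v.1 a))) : u ⋖ v ∨ v ⋖ u := by
  have hne : u ≠ v := by
    rintro rfl
    have := huv.2
    rw [segment_same, vectorSpan_singleton, finrank_bot] at this
    exact zero_ne_one this
  have hinj : ∀ x y : W, x.1 a = y.1 a → x = y := fun x y hxy => h.inversions_injective <| by
    simp only [inversions, hxy]
  have hset : {w : W | w.1 a ∈ segment ℝ (u.1 a) (v.1 a)} = {u, v} := by
    ext w
    refine ⟨fun hw => ?_, ?_⟩
    · have hw : w.1 a ∈ segment ℝ (u.1 a) (v.1 a) := hw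
      rw [← insert_endpoints_openSegment] at hw
      rcases hw with hw | hw | hw
      · exact .inl (hinj _ _ hw)
      · exact .inr (hinj _ _ hw)
      -- Orbit points are extreme, so none lies strictly between `u a` and `v a`; the face then
      -- corresponds to a two-element interval.
      · have hext := exposedPoints_subset_extremePoints (h.apply_mem_exposedPoints w)
        have hP : ∀ x : W, x.1 a ∈ perm W a := fun x => subset_convexHull ℝ _ ⟨x, rfl⟩
        exact .inl (hinj _ _ (hext.2 (hP u) (hP v) hw).symm)
    · rintro (rfl | rfl)
      exacts [left_mem_segment _ _ _, right_mem_segment _ _ _]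
  obtain ⟨c, -, hc⟩ := huv.1.exists_maximizers
  obtain ⟨x, y, hxy, hIcc⟩ := h.exists_maximizers_eq_Icc hle c
  rw [← hc, hset] at hIcc
  have hcov : ∀ x y : W, x ≠ y → x ≤ y → {x, y} = Set.Icc x y → x ⋖ y := fun x y hne hxy heq =>
    ⟨lt_of_le_of_ne hxy hne, fun z hz hz' => by
      have : z ∈ ({x, y} : Set W) := heq ▸ ⟨hz.le, hz'.le⟩
      rcases this with rfl | rfl
      exacts [hz.false, hz'.false]⟩
  have hx : x ∈ ({u, v} : Set W) := hIcc ▸ Set.left_mem_Icc.2 hxy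
  have hy : y ∈ ({u, v} : Set W) := hIcc ▸ Set.right_mem_Icc.2 hxy
  rcases hx with rfl | rfl <;> rcases hy with rfl | rfl
  · rw [Set.Icc_self] at hIcc
    exact absurd (hIcc ▸ Set.mem_insert_of_mem _ rfl : v ∈ ({y} : Set W)) hne.symm
  · exact .inl (hcov _ _ hne hxy hIcc)
  · exact .inr (hcov _ _ hne.symm hxy (by rw [Set.pair_comm]; exact hIcc))
  · rw [Set.Icc_self] at hIcc
    exact absurd (hIcc ▸ Set.mem_insert _ _ : u ∈ ({y} : Set W)) hne

theorem length_lt_length (h : IsBasis W Φ a Δ) [PartialOrder W]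
    (hle : ∀ u v : W, u ≤ v ↔ inversions Φ a u ⊆ inversions Φ a v) {u v : W} (huv : u < v) :
    length (simpleReflections W Δ) u < length (simpleReflections W Δ) v := by
  rw [h.length_eq_ncard_inversions, h.length_eq_ncard_inversions]
  refine Set.ncard_lt_ncard ⟨(hle u v).1 huv.le, fun h' => ?_⟩ (h.finite_inversions v)
  exact huv.not_ge ((hle v u).2 h')

end IsBasis

end

end CoxeterPerm

/-! ### The four statements combined -/

theorem mainTheorem4 {V : Type*} [NormedAddCommGroup V] [InnerProductSpace ℝ V]
    [FiniteDimensional ℝ V] (W : Subgroup (V ≃ₗᵢ[ℝ] V)) [Finite W]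
    (hW : CoxeterPerm.IsReflectionGroup W)
    (Φ : Set V) (hΦ : CoxeterPerm.IsRootSystem W Φ)
    (a : V) (ha : CoxeterPerm.IsGeneric W a)
    (Δ : Set V) (hΔ : CoxeterPerm.IsSimpleSystem Φ Δ) (haΔ : ∀ α ∈ Δ, 0 < inner ℝ a α)
    (S : Set W) (hS : S = CoxeterPerm.simpleReflections W Δ)
    (P : Set V) (hP : P = CoxeterPerm.perm W a) :
    -- the right weak order is (a partial order and) a lattice on `W`
    ∃ L : Lattice W, (∀ u v : W, u ≤ v ↔ CoxeterPerm.RightWeakLE S u v) ∧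
      -- `w ↦ w(a)` identifies `W` with the vertices; every edge has endpoints of different length,
      -- and the edges oriented by increasing length are exactly the cover relations
      (∃ e : W ≃ P.exposedPoints ℝ, (∀ w : W, (e w : V) = (w : V ≃ₗᵢ[ℝ] V) a) ∧
        (∀ u v : W, (CoxeterPerm.oneSkeleton P).Adj (e u) (e v) →
          CoxeterPerm.length S u ≠ CoxeterPerm.length S v) ∧
        (∀ u v : W, ((CoxeterPerm.oneSkeleton P).Adj (e u) (e v) ∧
          CoxeterPerm.length S u < CoxeterPerm.length S v) ↔ u ⋖ v)) ∧
      -- the minimum is the identity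
      (∀ w : W, 1 ≤ w) ∧
      -- there is a maximum `wo`, which is the unique longest element
      (∃ wo : W, (∀ w : W, w ≤ wo) ∧
        ∀ w : W, w ≠ wo → CoxeterPerm.length S w < CoxeterPerm.length S wo) ∧
      -- the vertices of each nonempty face form an interval, and the face is their convex hull
      (∀ F : Set V, CoxeterPerm.IsFace P F → ∃ u v : W, u ≤ v ∧
        {w : W | (w : V ≃ₗᵢ[ℝ] V) a ∈ F} = Set.Icc u v ∧
        F = convexHull ℝ ((fun w : W => (w : V ≃ₗᵢ[ℝ] V) a) '' Set.Icc u v)) := by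
  subst hS hP
  have h := hΦ.isBasis ha hΔ haΔ
  obtain ⟨L, hle⟩ := h.exists_lattice
  obtain ⟨e, he⟩ := h.exists_equiv_exposedPoints
  have hadj : ∀ u v : W, (CoxeterPerm.oneSkeleton (CoxeterPerm.perm W a)).Adj (e u) (e v) ↔
      CoxeterPerm.IsEdge (CoxeterPerm.perm W a) (segment ℝ (u.1 a) (v.1 a)) := fun u v => by
    rw [← he, ← he]
    rfl
  refine ⟨L, fun u v => (hle u v).trans (h.rightWeakLE_iff u v).symm, ⟨e, he, ?_, ?_⟩, ?_, ?_, ?_⟩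
  · intro u v huv
    rw [hadj] at huv
    rcases h.covBy_or_covBy_of_isEdge hle huv with hc | hc
    · exact (h.length_lt_length hle hc.lt).ne
    · exact (h.length_lt_length hle hc.lt).ne'
  · intro u v
    rw [hadj]
    constructor
    · rintro ⟨huv, hlt⟩
      exact (h.covBy_or_covBy_of_isEdge hle huv).resolve_right fun hc =>
        hlt.not_gt (h.length_lt_length hle hc.lt)
    · intro hc
      exact ⟨h.isEdge_of_covBy hle hc, h.length_lt_length hle hc.lt⟩
  · intro w
    rw [hle, CoxeterPerm.inversions_one]
    exact Set.empty_subset _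
  · obtain ⟨wo, hwo⟩ := h.exists_longest
    have htop : ∀ w : W, w ≤ wo := fun w => (hle w wo).2 fun β hβ => hwo β hβ.1 hβ.2.1
    exact ⟨wo, htop, fun w hw => h.length_lt_length hle (lt_of_le_of_ne (htop w) hw)⟩
  · intro F hF
    obtain ⟨c, hFc, hc⟩ := hF.exists_maximizers
    obtain ⟨u, v, huv, hIcc⟩ := h.exists_maximizers_eq_Icc hle c
    exact ⟨u, v, huv, hc.trans hIcc, by rw [← hIcc]; exact hFc⟩
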